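/- For $n,k\in\mathbb N$, a random vector $X\in\{\pm1\}^n$ is $k$-wise independent if any at most $k$ of its coordinates are jointly distributed as independent uniform signs. For $\delta,T\in\mathbb R$ let $k(n,\delta,T)$ be the minimum $k$ such that every $k$-wise independent $X\in\{\pm1\}^n$ satisfies $$\Pr[\,|X\cdot r|\ge T\,]\le\delta\qquad\text{for all } r\in\{\pm1\}^n$$ (with $k(n,\delta,T)=\infty$ if there is no such $k$). Write $\log$ for the natural logarithm. (a) Let $c\ge5$, $0<\delta<1$, $n\in\mathbb N$ and $T=c\sqrt{n\log(1/\delta)}$. Assume that $T\le n$ (which is automatic from the next assumption if, say, $\delta\le 0.98$) and that $n\ge(12c)^2\,(3\log(1/\delta))^3$. Then $$k(n,\delta,T)>\frac{\log(1/\delta)}{9\log c}.$$ (b) Consequently, there is an absolute constant $C>0$ such that for all $c>5$ and $0<\delta<1$ there is an $N$ with $$k\bigl(n,\delta,c\sqrt{n\log(1/\delta)}\bigr)\ge C\log_c(1/\delta)\qquad\text{for all } n\ge N.$$ -/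

import Mathlib

noncomputable section

/-- The probability of the event `A` when `X` has law `p` on the hypercube `{±1}ⁿ`.
The two-element group `ℤˣ = {1, -1}` serves as `{±1}`. -/
def cubeProb {n : ℕ} (p : PMF (Fin n → ℤˣ)) (A : Set (Fin n → ℤˣ)) : ℝ :=
  (p.toOuterMeasure A).toReal

/-- `p` is the law of a `k`-wise independent `X ∈ {±1}ⁿ`: any at most `k` coordinates of `X` are
jointly distributed as independent uniform signs. -/
def IsKWiseIndependent {n : ℕ} (k : ℕ) (p : PMF (Fin n → ℤˣ)) : Prop :=
  ∀ S : Finset (Fin n), S.card ≤ k → ∀ a : Fin n → ℤˣ,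
    cubeProb p {x | ∀ i ∈ S, x i = a i} = (1 / 2 : ℝ) ^ S.card

/-- The inner product `x · r` of two sign vectors. -/
def signDot {n : ℕ} (x r : Fin n → ℤˣ) : ℝ :=
  ∑ i, (((x i : ℤ) : ℝ) * ((r i : ℤ) : ℝ))

/-- Every `k`-wise independent `X ∈ {±1}ⁿ` satisfies `P(|X · r| ≥ T) ≤ δ` for all `r ∈ {±1}ⁿ`. -/
def KWiseTailBound (n : ℕ) (δ T : ℝ) (k : ℕ) : Prop :=
  ∀ p : PMF (Fin n → ℤˣ), IsKWiseIndependent k p →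
    ∀ r : Fin n → ℤˣ, cubeProb p {x | T ≤ |signDot x r|} ≤ δ

/-- `k(n, δ, T)`: the least `k` such that `k`-wise independence forces the tail bound
(`⊤` if there is none, that is, if not even the uniform distribution satisfies it). -/
def minIndependence (n : ℕ) (δ T : ℝ) : ℕ∞ :=
  ⨅ (k : ℕ) (_ : KWiseTailBound n δ T k), (k : ℕ∞)

end

/-! For each `k` up to the claimed bound there is a `k`-wise independent law that violates the tail
bound at `r = 1`. The law is exchangeable, so it is determined by the distribution of the number `m`
of `1`s, taken to be binomial plus a signed perturbation `ν`. Prescribing at most `k` coordinates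
averages `ν` against a polynomial in `m` of degree at most `k`; hence `k`-wise independence holds
once `ν` annihilates such polynomials (`exists_isKWiseIndependent`).

Cut the integers from `n / 2` upwards into blocks of length `w`. Spread mass `2δ` over block `M`,
where `X · 1 ≥ T`, and subtract `2δ` times the Lagrange weights for extrapolating from `0, …, k` to
`M` on blocks `0, …, k`. These weights are at most `(2eM/k)^k`, while the binomial masses near the
centre are at least about `e^{-k}/√n` when `w ≈ √(n/k)/4`. Writing `L = log (1/δ)`, one has `M ≲
c√(kL)`, so positivity reduces to a bound of the form `k (C₀ c √(L/k))^k e^k ≲ e^L`, true when `L/k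
≥ 9 log c` (`mul_pow_le_exp`). -/

noncomputable section

/-! ### Exchangeable laws and `k`-wise independence. -/

/-- The number of coordinates of a sign vector equal to `1`. -/
def plusCount {n : ℕ} (x : Fin n → ℤˣ) : ℕ := (Finset.univ.filter fun i => x i = 1).card

lemma plusCount_le {n : ℕ} (x : Fin n → ℤˣ) : plusCount x ≤ n := by
  simpa [plusCount] using Finset.card_filter_le (Finset.univ : Finset (Fin n)) (fun i => x i = 1)

lemma signDot_one {n : ℕ} (x : Fin n → ℤˣ) : signDot x 1 = 2 * (plusCount x : ℝ) - n := by
  have h : ∀ i, (((x i : ℤ) : ℝ) * (((1 : Fin n → ℤˣ) i : ℤ) : ℝ))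
      = 2 * (if x i = 1 then (1 : ℝ) else 0) - 1 := by
    intro i
    rcases Int.units_eq_one_or (x i) with h | h
    · simp [h]; norm_num
    · simp [h]
  rw [signDot, Finset.sum_congr rfl fun i _ => h i, Finset.sum_sub_distrib, ← Finset.mul_sum,
    Finset.sum_boole]
  simp [plusCount]

/-- Sums over a subcube of a function of the number of `1`s. -/
lemma sum_cylinder {n : ℕ} (S : Finset (Fin n)) (a : Fin n → ℤˣ) (g : ℕ → ℝ) :
    ∑ x ∈ (Finset.univ : Finset (Fin n → ℤˣ)).filter (fun x => ∀ i ∈ S, x i = a i),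
        g (plusCount x) =
      ∑ j ∈ Finset.range (n - S.card + 1),
        ((n - S.card).choose j : ℝ) * g ((S.filter fun i => a i = 1).card + j) := by
  have hc : Sᶜ.card = n - S.card := by simp [Finset.card_compl]
  rw [← hc]
  have := Finset.sum_powerset_apply_card
    (fun j => g ((S.filter fun i => a i = 1).card + j)) (x := Sᶜ)
  simp only [nsmul_eq_mul] at this
  rw [← this]
  refine Finset.sum_nbij' (fun x => Sᶜ.filter fun i => x i = 1)
    (fun A i => if i ∈ S then a i else if i ∈ A then 1 else -1) ?_ ?_ ?_ ?_ ?_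
  · intro x _
    simp
  · intro A _
    simp +contextual
  · intro x hx
    simp only [Finset.mem_filter, Finset.mem_univ, true_and] at hx
    funext i
    by_cases hi : i ∈ S
    · simp [hi, hx i hi]
    · rcases Int.units_eq_one_or (x i) with h | h <;> simp [hi, h]
  · intro A hA
    rw [Finset.mem_powerset] at hA
    ext i
    by_cases hi : i ∈ S
    · have : i ∉ A := fun h => by simpa [hi] using hA h
      simp [hi, this]
    · by_cases hA' : i ∈ A <;> simp [hi, hA']
  · intro x hx
    simp only [Finset.mem_filter, Finset.mem_univ, true_and] at hx
    congr 1
    have h1 : (S.filter fun i => a i = 1) = S.filter fun i => x i = 1 :=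
      Finset.filter_congr fun i hi => by rw [hx i hi]
    rw [h1, plusCount, ← Finset.card_union_of_disjoint, ← Finset.filter_union,
      Finset.union_compl]
    exact Finset.disjoint_filter_filter disjoint_compl_right

lemma sum_plusCount {n : ℕ} (g : ℕ → ℝ) :
    ∑ x : Fin n → ℤˣ, g (plusCount x) =
      ∑ j ∈ Finset.range (n + 1), (n.choose j : ℝ) * g j := by
  simpa using sum_cylinder (n := n) ∅ 1 g

/-- Multiplied by `a! b!`, both sides become `n!` with `n = t + a + u + b`. This makes `(n-s).choose
j / n.choose (t+j)`, where `s = t + u`, a polynomial of degree `s` in `m = t + j`, up to a constant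
factor. -/
lemma choose_mul_descFactorial_add (t u a b : ℕ) :
    (a + b).choose a * (t + a + (u + b)).descFactorial (t + u) =
      (t + a + (u + b)).choose (t + a) * ((t + a).descFactorial t * (u + b).descFactorial u) := by
  have h1 := Nat.add_choose_mul_factorial_mul_factorial a b
  have h2 := Nat.add_choose_mul_factorial_mul_factorial (t + a) (u + b)
  rw [← Nat.choose_symm_add] at h1 h2
  have h3 := Nat.factorial_mul_descFactorial (show t + u ≤ t + a + (u + b) by omega)
  have h4 := Nat.factorial_mul_descFactorial (show t ≤ t + a by omega)
  have h5 := Nat.factorial_mul_descFactorial (show u ≤ u + b by omega)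
  rw [show t + a + (u + b) - (t + u) = a + b by omega] at h3
  rw [Nat.add_sub_cancel_left] at h4 h5
  have hp : 0 < a.factorial * b.factorial := by positivity
  refine Nat.eq_of_mul_eq_mul_right hp ?_
  calc _ = ((a + b).choose a * a.factorial * b.factorial) *
        (t + a + (u + b)).descFactorial (t + u) := by ring
    _ = (t + a + (u + b)).choose (t + a) * (a.factorial * (t + a).descFactorial t) *
        (b.factorial * (u + b).descFactorial u) := by rw [h1, h3, h4, h5, h2]
    _ = _ := by ring

open Polynomial in
/-- The polynomial `m ↦ m(m-1)⋯(m-t+1) · (n-m)(n-m-1)⋯(n-m-u+1)`. -/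
def cylinderPoly (n t u : ℕ) : ℝ[X] :=
  descPochhammer ℝ t * (descPochhammer ℝ u).comp (C (n : ℝ) - X)

lemma natDegree_cylinderPoly_le (n t u : ℕ) : (cylinderPoly n t u).natDegree ≤ t + u := by
  refine Polynomial.natDegree_mul_le.trans ?_
  rw [descPochhammer_natDegree, Polynomial.natDegree_comp, descPochhammer_natDegree]
  have : (Polynomial.C (n : ℝ) - Polynomial.X).natDegree ≤ 1 := by
    compute_degree
  nlinarith

lemma eval_cylinderPoly {n t u m : ℕ} (hm : m ≤ n) :
    (cylinderPoly n t u).eval (m : ℝ) = (m.descFactorial t * (n - m).descFactorial u : ℕ) := by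
  rw [cylinderPoly, Polynomial.eval_mul, Polynomial.eval_comp,
    descPochhammer_eval_eq_descFactorial, Polynomial.eval_sub, Polynomial.eval_C,
    Polynomial.eval_X, ← Nat.cast_sub hm, descPochhammer_eval_eq_descFactorial]
  push_cast
  rfl

lemma sum_cylinder_eq_zero {n k : ℕ} (ν : ℕ → ℝ)
    (hν : ∀ P : Polynomial ℝ, P.natDegree ≤ k →
      ∑ m ∈ Finset.range (n + 1), ν m * P.eval (m : ℝ) = 0)
    {s t : ℕ} (hts : t ≤ s) (hsn : s ≤ n) (hsk : s ≤ k) :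
    ∑ j ∈ Finset.range (n - s + 1),
      ((n - s).choose j : ℝ) * (ν (t + j) / (n.choose (t + j) : ℝ)) = 0 := by
  obtain ⟨u, rfl⟩ := Nat.exists_eq_add_of_le hts
  have hd : (0 : ℝ) < (n.descFactorial (t + u) : ℝ) := by
    exact_mod_cast Nat.descFactorial_pos.2 hsn
  have key : ∀ j ∈ Finset.range (n - (t + u) + 1),
      ((n - (t + u)).choose j : ℝ) * (ν (t + j) / (n.choose (t + j) : ℝ)) =
        (ν (t + j) * (cylinderPoly n t u).eval ((t + j : ℕ) : ℝ)) /
          (n.descFactorial (t + u) : ℝ) := by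
    intro j hj
    have hj' : j ≤ n - (t + u) := by simpa [Nat.lt_succ_iff] using hj
    obtain ⟨b, hb⟩ := Nat.exists_eq_add_of_le hj'
    have hn : n = t + j + (u + b) := by omega
    rw [eval_cylinderPoly (by omega)]
    have hc : (0 : ℝ) < (n.choose (t + j) : ℝ) := by
      exact_mod_cast Nat.choose_pos (by omega)
    have h := choose_mul_descFactorial_add t u j b
    rw [← hn, ← hb] at h
    have e : n - (t + j) = u + b := by omega
    rw [e]
    have h' : ((n - (t + u)).choose j : ℝ) * n.descFactorial (t + u) =
      n.choose (t + j) * (((t + j).descFactorial t * (u + b).descFactorial u : ℕ) : ℝ) := by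
      exact_mod_cast h
    rw [← mul_div_assoc, div_eq_div_iff hc.ne' hd.ne']
    linear_combination ν (t + j) * h'
  rw [Finset.sum_congr rfl key, ← Finset.sum_div,
    ← zero_div (n.descFactorial (t + u) : ℝ),
    ← hν _ ((natDegree_cylinderPoly_le n t u).trans hsk)]
  congr 1
  rw [← Finset.sum_image (s := Finset.range (n - (t + u) + 1)) (g := fun j => t + j)
    (f := fun m => ν m * (cylinderPoly n t u).eval (m : ℝ)) (by intro a _ b _ h; simpa using h)]
  -- The values of `m` missing from the cylinder sum are those with `m < t` or `n - m < u`, exactly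
  -- where a falling factorial vanishes.
  refine Finset.sum_subset ?_ ?_
  · intro m hm
    simp only [Finset.mem_image, Finset.mem_range] at hm ⊢
    omega
  · intro m hm hm'
    simp only [Finset.mem_image, Finset.mem_range, not_exists, not_and] at hm hm'
    rw [eval_cylinderPoly (by omega)]
    by_cases h : m < t
    · simp [Nat.descFactorial_of_lt h]
    · have h2 : n - m < u := by
        by_contra h3
        exact hm' (m - t) (by omega) (by omega)
      simp [Nat.descFactorial_of_lt h2]

/-- A signed perturbation of the binomial law that annihilates polynomials of degree at most `k`
gives rise to an exchangeable `k`-wise independent law. -/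
lemma exists_isKWiseIndependent {n k : ℕ} (ν : ℕ → ℝ)
    (hν : ∀ P : Polynomial ℝ, P.natDegree ≤ k →
      ∑ m ∈ Finset.range (n + 1), ν m * P.eval (m : ℝ) = 0)
    (hpos : ∀ m ≤ n, 0 ≤ (n.choose m : ℝ) / 2 ^ n + ν m) :
    ∃ p : PMF (Fin n → ℤˣ), IsKWiseIndependent k p ∧ ∀ B : Finset ℕ,
      cubeProb p {x | plusCount x ∈ B} =
        ∑ m ∈ (Finset.range (n + 1)).filter (· ∈ B), ((n.choose m : ℝ) / 2 ^ n + ν m) := by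
  -- Mass of a single point with `m` ones: each level set shares its total mass equally.
  set f : ℕ → ℝ := fun m => 1 / 2 ^ n + ν m / n.choose m with hf
  have hcf : ∀ m ≤ n, (n.choose m : ℝ) * f m = (n.choose m : ℝ) / 2 ^ n + ν m := by
    intro m hm
    have hc : (0 : ℝ) < (n.choose m : ℝ) := by exact_mod_cast Nat.choose_pos hm
    simp only [hf]
    field_simp
  have hf0 : ∀ m ≤ n, 0 ≤ f m := by
    intro m hm
    have hc : (0 : ℝ) < (n.choose m : ℝ) := by exact_mod_cast Nat.choose_pos hm
    exact nonneg_of_mul_nonneg_right (by rw [hcf m hm]; exact hpos m hm) hc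
  have hcyl : ∀ S : Finset (Fin n), S.card ≤ k → ∀ a : Fin n → ℤˣ,
      ∑ x ∈ (Finset.univ : Finset (Fin n → ℤˣ)).filter (fun x => ∀ i ∈ S, x i = a i),
        f (plusCount x) = (1 / 2 : ℝ) ^ S.card := by
    intro S hS a
    have hSn : S.card ≤ n := by simpa using S.card_le_univ
    rw [sum_cylinder]
    simp only [hf, mul_add, Finset.sum_add_distrib]
    rw [sum_cylinder_eq_zero ν hν (Finset.card_filter_le _ _) hSn hS, add_zero, ← Finset.sum_mul]
    have h2 : ∑ j ∈ Finset.range (n - S.card + 1), ((n - S.card).choose j : ℝ) =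
        2 ^ (n - S.card) := by
      exact_mod_cast Nat.sum_range_choose (n - S.card)
    rw [h2, pow_sub₀ _ two_ne_zero hSn, one_div_pow]
    field_simp
  have hsum : ∑ x : Fin n → ℤˣ, ENNReal.ofReal (f (plusCount x)) = 1 := by
    rw [← ENNReal.ofReal_sum_of_nonneg fun x _ => hf0 _ (plusCount_le x)]
    have := hcyl ∅ (by simp) 1
    simp only [Finset.notMem_empty, false_imp_iff, implies_true, Finset.filter_true,
      Finset.card_empty, pow_zero] at this
    rw [this, ENNReal.ofReal_one]
  have hprob : ∀ (q : (Fin n → ℤˣ) → Prop) [DecidablePred q],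
      cubeProb (PMF.ofFintype _ hsum) {x | q x} =
        ∑ x ∈ (Finset.univ : Finset (Fin n → ℤˣ)).filter q, f (plusCount x) := by
    intro q _
    rw [cubeProb, PMF.toOuterMeasure_apply_fintype, Finset.sum_filter, ENNReal.toReal_sum]
    · refine Finset.sum_congr rfl fun x _ => ?_
      by_cases hx : q x
      · simp [Set.indicator, hx, hf0 _ (plusCount_le x)]
      · simp [Set.indicator, hx]
    · intro x _
      by_cases hx : q x <;> simp [Set.indicator, hx]
  refine ⟨PMF.ofFintype _ hsum, fun S hS a => ?_, fun B => ?_⟩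
  · rw [hprob, hcyl S hS a]
  · rw [hprob, Finset.sum_filter, Finset.sum_filter]
    have := sum_plusCount (n := n) fun m => if m ∈ B then f m else 0
    rw [this]
    refine Finset.sum_congr rfl fun m hm => ?_
    have hm' : m ≤ n := by simpa [Nat.lt_succ_iff] using hm
    by_cases hB : m ∈ B
    · simp [hB, hcf m hm']
    · simp [hB]

/-! ### Signed weights annihilating polynomials of low degree. -/

lemma sum_range_mul_eq {M : Type*} [AddCommMonoid M] (g : ℕ → M) (w N : ℕ) :
    ∑ u ∈ Finset.range (w * N), g u =
      ∑ i ∈ Finset.range N, ∑ j ∈ Finset.range w, g (w * i + j) := by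
  induction N with
  | zero => simp
  | succ N ih => rw [Nat.mul_succ, Finset.sum_range_add, ih, Finset.sum_range_succ]

/-- The value at `M` of the Lagrange basis polynomial of the nodes `0, …, k` at `i`. -/
def lagrangeWeight (k M i : ℕ) : ℝ :=
  (Lagrange.basis (Finset.range (k + 1)) (fun j : ℕ => (j : ℝ)) i).eval (M : ℝ)

lemma sum_lagrangeWeight_mul {k M : ℕ} {Q : Polynomial ℝ} (hQ : Q.natDegree ≤ k) :
    ∑ i ∈ Finset.range (k + 1), lagrangeWeight k M i * Q.eval (i : ℝ) = Q.eval (M : ℝ) := by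
  have h := Lagrange.eq_interpolate (s := Finset.range (k + 1)) (v := fun j : ℕ => (j : ℝ))
    (f := Q) (fun a _ b _ h => by simpa using h) (by
      rw [Finset.card_range]
      exact lt_of_le_of_lt Polynomial.degree_le_natDegree (by exact_mod_cast Nat.lt_succ_of_le hQ))
  conv_rhs => rw [h]
  rw [Lagrange.interpolate_apply, Polynomial.eval_finsetSum]
  refine Finset.sum_congr rfl fun i _ => ?_
  rw [Polynomial.eval_mul, Polynomial.eval_C, mul_comm, lagrangeWeight]

lemma prod_erase_abs_sub {k i : ℕ} (hi : i ≤ k) :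
    ∏ j ∈ (Finset.range (k + 1)).erase i, |(i : ℝ) - j| =
      (i.factorial : ℝ) * ((k - i).factorial : ℝ) := by
  obtain ⟨b, rfl⟩ := Nat.exists_eq_add_of_le hi
  have h1 : ∏ j ∈ Finset.range i, |(i : ℝ) - j| = i.factorial := by
    rw [← Finset.prod_range_add_one_eq_factorial, ← Finset.prod_range_reflect]
    push_cast
    refine Finset.prod_congr rfl fun j hj => ?_
    have : j < i := by simpa using hj
    rw [show i - 1 - j = i - (j + 1) by omega, Nat.cast_sub (by omega), abs_of_nonneg]
    · push_cast; ring
    · push_cast; linarith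
  have h2 : ∏ j ∈ Finset.range b, |(i : ℝ) - (i + 1 + j : ℕ)| = b.factorial := by
    rw [← Finset.prod_range_add_one_eq_factorial]
    push_cast
    refine Finset.prod_congr rfl fun j _ => ?_
    rw [abs_sub_comm, abs_of_nonneg] <;> ring_nf
    positivity
  have hs : (Finset.range (i + b + 1)).erase i =
      Finset.range i ∪ (Finset.range b).image (fun j => i + 1 + j) := by
    ext j
    simp only [Finset.mem_erase, Finset.mem_range, Finset.mem_union, Finset.mem_image]
    constructor
    · intro h
      by_cases hj : j < i
      · exact Or.inl hj
      · exact Or.inr ⟨j - (i + 1), by omega, by omega⟩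
    · rintro (h | ⟨l, hl, rfl⟩) <;> omega
  rw [hs, Finset.prod_union, Finset.prod_image, h1, h2, Nat.add_sub_cancel_left]
  · intro a _ b _ h
    simpa using h
  · rw [Finset.disjoint_left]
    intro j hj hj'
    simp only [Finset.mem_range, Finset.mem_image] at hj hj'
    omega

/-- Each numerator factor `M - j` is at most `M`; the denominator `i! (k-i)!` is at least `k! / 2^k`
because `k.choose i ≤ 2^k`. -/
lemma abs_lagrangeWeight_le {k M i : ℕ} (hi : i ≤ k) (hM : k ≤ M) :
    |lagrangeWeight k M i| ≤ (M : ℝ) ^ k * 2 ^ k / k.factorial := by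
  have hmem : i ∈ Finset.range (k + 1) := by simpa [Nat.lt_succ_iff] using hi
  have hb : |lagrangeWeight k M i| = (∏ j ∈ (Finset.range (k + 1)).erase i, |(M : ℝ) - j|) /
      ((i.factorial : ℝ) * ((k - i).factorial : ℝ)) := by
    rw [← prod_erase_abs_sub hi, lagrangeWeight, Lagrange.basis, Polynomial.eval_prod,
      Finset.abs_prod, ← Finset.prod_div_distrib]
    refine Finset.prod_congr rfl fun j _ => ?_
    rw [Lagrange.basisDivisor]
    simp only [Polynomial.eval_mul, Polynomial.eval_C, Polynomial.eval_sub, Polynomial.eval_X]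
    rw [abs_mul, abs_inv, div_eq_inv_mul]
  have hn : ∏ j ∈ (Finset.range (k + 1)).erase i, |(M : ℝ) - j| ≤ (M : ℝ) ^ k := by
    have hc : ((Finset.range (k + 1)).erase i).card = k := by
      rw [Finset.card_erase_of_mem hmem]; simp
    calc _ ≤ ∏ j ∈ (Finset.range (k + 1)).erase i, (M : ℝ) := by
          refine Finset.prod_le_prod (fun j _ => abs_nonneg _) fun j hj => ?_
          have hj' : j ≤ M := by
            have := Finset.mem_range.1 (Finset.mem_of_mem_erase hj)
            omega
          have h1 : (j : ℝ) ≤ M := by exact_mod_cast hj'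
          rw [abs_of_nonneg (by linarith)]
          have : (0 : ℝ) ≤ j := Nat.cast_nonneg j
          linarith
      _ = _ := by rw [Finset.prod_const, hc]
  have hfac : (k.factorial : ℝ) ≤ 2 ^ k * ((i.factorial : ℝ) * ((k - i).factorial : ℝ)) := by
    have h := Nat.choose_mul_factorial_mul_factorial hi
    have h2 : k.choose i ≤ 2 ^ k := Nat.choose_le_two_pow k i
    rw [← h]
    push_cast
    rw [mul_assoc]
    have h2' : (k.choose i : ℝ) ≤ 2 ^ k := by exact_mod_cast h2
    gcongr
  rw [hb, div_le_div_iff₀ (by positivity) (by positivity)]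
  calc _ ≤ (M : ℝ) ^ k * (2 ^ k * ((i.factorial : ℝ) * ((k - i).factorial : ℝ))) := by gcongr
    _ = _ := by ring

lemma abs_lagrangeWeight_le_pow {k M i : ℕ} (hk : 0 < k) (hi : i ≤ k) (hM : k ≤ M) :
    |lagrangeWeight k M i| ≤ (2 * Real.exp 1 * M / k) ^ k := by
  refine (abs_lagrangeWeight_le hi hM).trans ?_
  have h := Real.pow_div_factorial_le_exp (x := (k : ℝ)) (Nat.cast_nonneg k) k
  have hk' : (0 : ℝ) < k := by exact_mod_cast hk
  rw [div_le_iff₀ (by positivity)] at h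
  have he : Real.exp (k : ℝ) = Real.exp 1 ^ k := by rw [← Real.exp_nat_mul, mul_one]
  rw [he] at h
  rw [div_pow, mul_pow, mul_pow, div_le_div_iff₀ (by positivity) (by positivity)]
  calc _ ≤ (M : ℝ) ^ k * 2 ^ k * (Real.exp 1 ^ k * (k.factorial : ℝ)) := by gcongr
    _ = _ := by ring

/-- Weights on `ℕ` supported on `{0, …, k} ∪ {M}` that annihilate polynomials of degree `≤ k`. -/
def annihilatingWeight (k M i : ℕ) : ℝ :=
  if i ≤ k then -lagrangeWeight k M i else if i = M then 1 else 0

lemma sum_annihilatingWeight_mul {k M : ℕ} (hM : k < M) {Q : Polynomial ℝ}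
    (hQ : Q.natDegree ≤ k) :
    ∑ i ∈ Finset.range (M + 1), annihilatingWeight k M i * Q.eval (i : ℝ) = 0 := by
  have h1 : ∑ i ∈ Finset.range (k + 1), annihilatingWeight k M i * Q.eval (i : ℝ) =
      -Q.eval (M : ℝ) := by
    rw [← sum_lagrangeWeight_mul hQ, ← Finset.sum_neg_distrib]
    refine Finset.sum_congr rfl fun i hi => ?_
    have : i ≤ k := by simpa [Nat.lt_succ_iff] using hi
    simp [annihilatingWeight, this]
  have h2 : ∑ i ∈ Finset.range M, annihilatingWeight k M i * Q.eval (i : ℝ) =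
      ∑ i ∈ Finset.range (k + 1), annihilatingWeight k M i * Q.eval (i : ℝ) := by
    symm
    refine Finset.sum_subset (by simpa using hM) fun i hi hi' => ?_
    simp only [Finset.mem_range, not_lt] at hi hi'
    rw [annihilatingWeight, if_neg (by omega), if_neg (by omega), zero_mul]
  rw [Finset.sum_range_succ, h2, h1, annihilatingWeight, if_neg (by omega), if_pos rfl]
  ring

/-- The annihilating weights spread over blocks of length `w` starting at `h`. -/
def blockWeight (k M h w : ℕ) (m : ℕ) : ℝ :=
  if h ≤ m then annihilatingWeight k M ((m - h) / w) else 0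

lemma blockWeight_add {k M h w i j : ℕ} (hj : j < w) :
    blockWeight k M h w (h + (w * i + j)) = annihilatingWeight k M i := by
  rw [blockWeight, if_pos (by omega), Nat.add_sub_cancel_left,
    Nat.mul_add_div (by omega), Nat.div_eq_of_lt hj, add_zero]

/-- For a fixed offset `j` inside the blocks, `P (h + w i + j)` is a polynomial in `i` of degree at
most `k`, so each offset contributes zero separately. -/
lemma sum_blockWeight_mul {k M h w n : ℕ} (hM : k < M) (hw : 0 < w)
    (hn : h + w * (M + 1) ≤ n + 1) {P : Polynomial ℝ} (hP : P.natDegree ≤ k) :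
    ∑ m ∈ Finset.range (n + 1), blockWeight k M h w m * P.eval (m : ℝ) = 0 := by
  have h1 : ∑ m ∈ Finset.range (n + 1), blockWeight k M h w m * P.eval (m : ℝ) =
      ∑ m ∈ Finset.range (h + w * (M + 1)), blockWeight k M h w m * P.eval (m : ℝ) := by
    symm
    refine Finset.sum_subset (by simpa using hn) fun m hm hm' => ?_
    simp only [Finset.mem_range, not_lt] at hm hm'
    have : M + 1 ≤ (m - h) / w := by
      rw [Nat.le_div_iff_mul_le hw, mul_comm]
      omega
    rw [blockWeight, if_pos (by omega), annihilatingWeight, if_neg (by omega),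
      if_neg (by omega), zero_mul]
  rw [h1, Finset.sum_range_add, sum_range_mul_eq, Finset.sum_comm]
  have h2 : ∑ m ∈ Finset.range h, blockWeight k M h w m * P.eval (m : ℝ) = 0 := by
    refine Finset.sum_eq_zero fun m hm => ?_
    have : m < h := by simpa using hm
    rw [blockWeight, if_neg (by omega), zero_mul]
  rw [h2, zero_add]
  refine Finset.sum_eq_zero fun j hj => ?_
  have hj' : j < w := by simpa using hj
  set R : Polynomial ℝ := P.comp (Polynomial.C (w : ℝ) * Polynomial.X +
    Polynomial.C ((h + j : ℕ) : ℝ)) with hR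
  have hdeg : R.natDegree ≤ k := by
    rw [hR, Polynomial.natDegree_comp]
    have := Polynomial.natDegree_linear_le (a := (w : ℝ)) (b := ((h + j : ℕ) : ℝ))
    nlinarith
  rw [← sum_annihilatingWeight_mul hM hdeg]
  refine Finset.sum_congr rfl fun i _ => ?_
  rw [blockWeight_add hj', hR]
  simp only [Polynomial.eval_comp, Polynomial.eval_add, Polynomial.eval_mul, Polynomial.eval_C,
    Polynomial.eval_X]
  push_cast
  ring_nf

/-! ### Lower bounds for binomial coefficients near the centre. -/

lemma four_pow_le_centralBinom (m : ℕ) (hm : 0 < m) :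
    (4 : ℝ) ^ m ≤ 2 * Real.sqrt m * (m.centralBinom : ℝ) := by
  -- The squared form is inductive because `4m(m+1) ≤ (2m+1)^2`.
  have key : ((4 : ℝ) ^ m) ^ 2 ≤ 4 * m * (m.centralBinom : ℝ) ^ 2 := by
    induction m, hm using Nat.le_induction with
    | base => norm_num [Nat.centralBinom, Nat.choose]
    | succ m hm ih =>
      have h : ((m : ℝ) + 1) * ((m + 1).centralBinom : ℝ) =
          2 * (2 * m + 1) * (m.centralBinom : ℝ) := by
        exact_mod_cast Nat.succ_mul_centralBinom_succ m
      have hm1 : (0 : ℝ) < m + 1 := by positivity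
      refine le_of_mul_le_mul_left ?_ hm1
      have e : ((m : ℝ) + 1) * (4 * ((m + 1 : ℕ) : ℝ) * ((m + 1).centralBinom : ℝ) ^ 2) =
          4 * (2 * (2 * m + 1) * (m.centralBinom : ℝ)) ^ 2 := by
        rw [← h]; push_cast; ring
      rw [e, show ((4 : ℝ) ^ (m + 1)) ^ 2 = 16 * (4 ^ m) ^ 2 by ring]
      nlinarith [mul_le_mul_of_nonneg_left ih hm1.le, sq_nonneg (m.centralBinom : ℝ)]
  refine abs_le_of_sq_le_sq' ?_ (by positivity) |>.2
  rw [mul_pow, mul_pow, Real.sq_sqrt (Nat.cast_nonneg m)]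
  linarith

lemma two_pow_le_choose_half (n : ℕ) (hn : 0 < n) :
    (2 : ℝ) ^ n ≤ Real.sqrt (2 * (n + 1)) * (n.choose (n / 2) : ℝ) := by
  rcases Nat.even_or_odd' n with ⟨m, rfl | rfl⟩
  · have h := four_pow_le_centralBinom m (by omega)
    rw [Nat.mul_div_cancel_left _ (by norm_num), ← Nat.centralBinom_eq_two_mul_choose, pow_mul]
    rw [show (2 : ℝ) ^ 2 = 4 by norm_num]
    push_cast
    refine h.trans (mul_le_mul_of_nonneg_right (Real.le_sqrt_of_sq_le ?_) (Nat.cast_nonneg _))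
    rw [mul_pow, Real.sq_sqrt (Nat.cast_nonneg m)]
    linarith
  · have h := four_pow_le_centralBinom (m + 1) (by omega)
    have hc : (m + 1).centralBinom = 2 * (2 * m + 1).choose m := by
      rw [Nat.centralBinom_eq_two_mul_choose, show 2 * (m + 1) = (2 * m + 1) + 1 by ring,
        Nat.choose_succ_succ, Nat.choose_symm_half]
      ring
    have e : 2 * Real.sqrt ((m + 1 : ℕ) : ℝ) = Real.sqrt (2 * (((2 * m + 1 : ℕ) : ℝ) + 1)) := by
      rw [show 2 * (((2 * m + 1 : ℕ) : ℝ) + 1) = 2 ^ 2 * ((m + 1 : ℕ) : ℝ) by push_cast; ring,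
        Real.sqrt_mul (by positivity), Real.sqrt_sq (by norm_num)]
    rw [e, hc] at h
    rw [show (2 * m + 1) / 2 = m by omega]
    push_cast at h ⊢
    have e2 : (4 : ℝ) ^ (m + 1) = 2 * 2 ^ (2 * m + 1) := by
      rw [show (4 : ℝ) = 2 ^ 2 by norm_num, ← pow_mul]; ring
    rw [e2] at h
    linarith

/-- Moving from `n/2 + u` to `n/2 + u + 1` costs a factor of at most `exp ((2u+1)/D)`; the odd
numbers sum to `u^2`. -/
lemma choose_half_le {n u D : ℕ} (hD : 0 < D) (hu : D + u ≤ n / 2) :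
    (n.choose (n / 2) : ℝ) ≤ n.choose (n / 2 + u) * Real.exp ((u : ℝ) ^ 2 / D) := by
  induction u with
  | zero => simp
  | succ u ih =>
    refine (ih (by omega)).trans ?_
    set h := n / 2 with hh
    have hD' : (0 : ℝ) < D := by exact_mod_cast hD
    have h1 := Nat.choose_succ_right_eq n (h + u)
    have h2 : (n.choose (h + u + 1) : ℝ) * (h + u + 1) =
        n.choose (h + u) * ((n - (h + u) : ℕ) : ℝ) := by exact_mod_cast h1
    have h3 : (D : ℝ) ≤ ((n - (h + u) : ℕ) : ℝ) := by exact_mod_cast (by omega)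
    have h4 : (h : ℝ) ≤ ((n - (h + u) : ℕ) : ℝ) + u := by exact_mod_cast (by omega)
    set q : ℝ := ((n - (h + u) : ℕ) : ℝ)
    have hE : (h + u + 1 : ℝ) ≤ q * Real.exp ((2 * u + 1) / D) := by
      have h5 := Real.add_one_le_exp ((2 * u + 1 : ℝ) / D)
      have h6 : q * ((2 * u + 1 : ℝ) / D + 1) ≤ q * Real.exp ((2 * u + 1) / D) := by gcongr
      have h7 : (2 * u + 1 : ℝ) ≤ q * ((2 * u + 1 : ℝ) / D) := by
        rw [mul_div_assoc', le_div_iff₀ hD']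
        nlinarith
      nlinarith
    have hq : 0 < q := lt_of_lt_of_le hD' h3
    have h8 : (n.choose (h + u) : ℝ) ≤
        n.choose (h + u + 1) * Real.exp ((2 * u + 1) / D) := by
      refine le_of_mul_le_mul_right ?_ hq
      rw [← h2]
      calc (n.choose (h + u + 1) : ℝ) * (h + u + 1)
          ≤ n.choose (h + u + 1) * (q * Real.exp ((2 * u + 1) / D)) := by gcongr
        _ = _ := by ring
    calc (n.choose (h + u) : ℝ) * Real.exp ((u : ℝ) ^ 2 / D)
        ≤ n.choose (h + u + 1) * Real.exp ((2 * u + 1) / D) * Real.exp ((u : ℝ) ^ 2 / D) := by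
          gcongr
      _ = n.choose (h + u + 1) * Real.exp (((u + 1 : ℕ) : ℝ) ^ 2 / D) := by
          rw [mul_assoc, ← Real.exp_add]
          congr 2
          push_cast
          ring

lemma le_choose_div_two_pow {n u D : ℕ} (hn : 0 < n) (hD : 0 < D) (hu : D + u ≤ n / 2) :
    Real.exp (-((u : ℝ) ^ 2 / D)) / Real.sqrt (2 * (n + 1)) ≤
      (n.choose (n / 2 + u) : ℝ) / 2 ^ n := by
  have h1 := two_pow_le_choose_half n hn
  have h2 := choose_half_le hD hu
  rw [div_le_div_iff₀ (by positivity) (by positivity)]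
  calc Real.exp (-((u : ℝ) ^ 2 / D)) * 2 ^ n
      ≤ Real.exp (-((u : ℝ) ^ 2 / D)) * (Real.sqrt (2 * (n + 1)) *
        (n.choose (n / 2 + u) * Real.exp ((u : ℝ) ^ 2 / D))) := by gcongr; exact h1.trans (by gcongr)
    _ = (Real.exp (-((u : ℝ) ^ 2 / D)) * Real.exp ((u : ℝ) ^ 2 / D)) *
        (n.choose (n / 2 + u) * Real.sqrt (2 * (n + 1))) := by ring
    _ = _ := by rw [← Real.exp_add]; simp

/-! ### The law violating the tail bound. -/

/-- The perturbed binomial law that puts extra mass `2δ` on a block of length `w` beyond `T`,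
compensated on `k + 1` blocks next to `n / 2`, violates the tail bound. -/
lemma not_kWiseTailBound_of_params {n k w M D : ℕ} {δ T : ℝ} (hδ : 0 < δ) (hk : 0 < k)
    (hw : 0 < w) (hM : k < M) (hn : n / 2 + w * (M + 1) ≤ n + 1) (hD : 0 < D)
    (hDw : D + w * (k + 1) ≤ n / 2) (hT : T + 1 ≤ 2 * (w * M))
    (hmain : 2 * δ / w * (2 * Real.exp 1 * M / k) ^ k ≤
      Real.exp (-(((w * (k + 1) : ℕ) : ℝ) ^ 2 / D)) / Real.sqrt (2 * (n + 1))) :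
    ¬ KWiseTailBound n δ T k := by
  intro hbound
  set h := n / 2 with hh
  have hw' : (0 : ℝ) < w := by exact_mod_cast hw
  set ν : ℕ → ℝ := fun m => 2 * δ / w * blockWeight k M h w m with hν
  have hpos : ∀ m ≤ n, 0 ≤ (n.choose m : ℝ) / 2 ^ n + ν m := by
    intro m _
    have hc0 : (0 : ℝ) ≤ (n.choose m : ℝ) / 2 ^ n := by positivity
    by_cases hm : h ≤ m
    · by_cases hik : (m - h) / w ≤ k
      · have hu : m - h ≤ w * (k + 1) := by
          have := (Nat.div_lt_iff_lt_mul hw).1 (Nat.lt_succ_of_le hik)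
          rw [mul_comm]; exact this.le
        have h1 := le_choose_div_two_pow (n := n) (u := m - h) (by omega) hD (by omega)
        rw [← hh, Nat.add_sub_cancel' hm] at h1
        have h2 := abs_lagrangeWeight_le_pow hk hik hM.le
        have h3 : |2 * δ / w * lagrangeWeight k M ((m - h) / w)| ≤ (n.choose m : ℝ) / 2 ^ n := by
          rw [abs_mul, abs_of_pos (by positivity : 0 < 2 * δ / w)]
          calc _ ≤ 2 * δ / w * (2 * Real.exp 1 * M / k) ^ k := by gcongr
            _ ≤ _ := hmain
            _ ≤ _ := by gcongr
            _ ≤ _ := h1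
        simp only [hν, blockWeight, if_pos hm, annihilatingWeight, if_pos hik, mul_neg]
        linarith [le_abs_self (2 * δ / w * lagrangeWeight k M ((m - h) / w))]
      · have : 0 ≤ ν m := by
          simp only [hν, blockWeight, if_pos hm, annihilatingWeight, if_neg hik]
          split_ifs <;> positivity
        linarith
    · have : ν m = 0 := by simp [hν, blockWeight, hm]
      linarith
  obtain ⟨p, hp, hprob⟩ := exists_isKWiseIndependent (n := n) (k := k) ν (by
    intro P hP
    simp only [hν, mul_assoc]
    rw [← Finset.mul_sum, sum_blockWeight_mul hM hw hn hP, mul_zero]) hpos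
  have h1 := hbound p hp 1
  set B : Finset ℕ := (Finset.range w).image fun j => h + (w * M + j) with hB
  have hBn : ∀ m ∈ B, m ∈ Finset.range (n + 1) := by
    intro m hm
    simp only [hB, Finset.mem_image, Finset.mem_range] at hm ⊢
    rw [Nat.mul_succ] at hn
    omega
  have h2 : cubeProb p {x | plusCount x ∈ B} ≤ cubeProb p {x | T ≤ |signDot x 1|} := by
    have hfin : p.toOuterMeasure {x | T ≤ |signDot x 1|} ≠ ⊤ :=
      ne_top_of_le_ne_top ENNReal.one_ne_top <| (p.toOuterMeasure.mono (Set.subset_univ _)).trans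
        ((PMF.toOuterMeasure_apply_eq_one_iff p _).2 (Set.subset_univ _)).le
    refine ENNReal.toReal_mono hfin (p.toOuterMeasure.mono fun x hx => ?_)
    simp only [Set.mem_ofPred_eq, hB, Finset.mem_image, Finset.mem_range] at hx ⊢
    obtain ⟨j, _, hj⟩ := hx
    rw [signDot_one, ← hj]
    refine le_trans ?_ (le_abs_self _)
    -- For odd `n` the rounding in `n / 2` loses one, hence the `T + 1` in `hT`.
    have h3 : (n : ℝ) ≤ 2 * h + 1 := by exact_mod_cast (by omega)
    push_cast
    have : (0 : ℝ) ≤ j := Nat.cast_nonneg j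
    linarith
  have h3 : 2 * δ ≤ cubeProb p {x | plusCount x ∈ B} := by
    rw [hprob, Finset.filter_mem_eq_inter, Finset.inter_eq_right.2 hBn, hB, Finset.sum_image
      (by intro a _ b _ h; simpa using h)]
    calc 2 * δ = ∑ j ∈ Finset.range w, 2 * δ / w := by
          rw [Finset.sum_const, Finset.card_range, nsmul_eq_mul]; field_simp
      _ ≤ _ := by
        refine Finset.sum_le_sum fun j hj => ?_
        have hν1 : ν (h + (w * M + j)) = 2 * δ / w := by
          simp only [hν]
          rw [blockWeight_add (by simpa using hj), annihilatingWeight, if_neg (by omega),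
            if_pos rfl, mul_one]
        rw [hν1]
        have : (0 : ℝ) ≤ (n.choose (h + (w * M + j)) : ℝ) / 2 ^ n := by positivity
        linarith
  linarith

/-! ### Choice of parameters. -/

lemma eight_fifths_le_log {c : ℝ} (hc : 5 ≤ c) : 8 / 5 ≤ Real.log c := by
  have h1 : Real.exp 8 ≤ 5 ^ 5 := by
    have : Real.exp 8 = Real.exp 1 ^ 8 := by rw [← Real.exp_nat_mul]; norm_num
    rw [this]
    calc Real.exp 1 ^ 8 ≤ 2.7182818286 ^ 8 := by gcongr; exact Real.exp_one_lt_d9.le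
      _ ≤ 5 ^ 5 := by norm_num
  have h2 := (Real.le_log_iff_exp_le (by norm_num)).2 h1
  rw [Real.log_pow] at h2
  have h3 := Real.log_le_log (by norm_num) hc
  push_cast at h2
  linarith

/-- With `c ≤ e^{y²/9}`, `y ≤ e^{2y²/9}` and `10 ≤ e^4`, the base is at most `e^{5 + y²/3}`. Since
`y² ≥ 14.4`, this is at most `e^{y² - 4}`, and the spare `e^{-4k}` absorbs `20k ≤ e^{3k}` and `e^k`.
-/
lemma mul_pow_le_exp {c y : ℝ} {k : ℕ} (hk : 0 < k) (hc : 5 ≤ c) (hy0 : 0 ≤ y)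
    (hy : 9 * Real.log c ≤ y ^ 2) :
    20 * (k : ℝ) * (10 * Real.exp 1 * c * y) ^ k * Real.exp k ≤ Real.exp (y ^ 2 * k) := by
  have hc0 : 0 < c := by linarith
  have hlog := eight_fifths_le_log hc
  have hy2 : 14.4 ≤ y ^ 2 := by linarith
  have hy3 : 3 ≤ y := by nlinarith
  have h1 : c ≤ Real.exp (y ^ 2 / 9) := by
    rw [← Real.log_le_iff_le_exp hc0]; linarith
  have h2 : y ≤ Real.exp (2 * y ^ 2 / 9) := by
    have := Real.add_one_le_exp (2 * y ^ 2 / 9)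
    nlinarith
  have he : (2.7 : ℝ) ≤ Real.exp 1 := by
    have := Real.exp_one_gt_d9
    linarith
  have h20 : (10 : ℝ) ≤ Real.exp 4 := by
    have : Real.exp 4 = Real.exp 1 ^ 4 := by rw [← Real.exp_nat_mul]; norm_num
    rw [this]
    calc (10 : ℝ) ≤ 2.7 ^ 4 := by norm_num
      _ ≤ _ := by gcongr
  have h3 : (20 : ℝ) * k ≤ Real.exp (3 * k) := by
    have e3 : (20 : ℝ) ≤ Real.exp 3 := by
      have : Real.exp 3 = Real.exp 1 ^ 3 := by rw [← Real.exp_nat_mul]; norm_num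
      rw [this]
      calc (20 : ℝ) ≤ 2.7182818283 ^ 3 := by norm_num
        _ ≤ _ := by gcongr; exact Real.exp_one_gt_d9.le
    have hk1 : (1 : ℝ) ≤ k := by exact_mod_cast hk
    have := Real.add_one_le_exp ((k : ℝ) - 1)
    calc (20 : ℝ) * k ≤ Real.exp 3 * Real.exp ((k : ℝ) - 1) := by
          gcongr; linarith
      _ = Real.exp (3 + ((k : ℝ) - 1)) := by rw [Real.exp_add]
      _ ≤ _ := by gcongr; linarith
  have h4 : 10 * Real.exp 1 * c * y ≤ Real.exp (y ^ 2 - 4) := by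
    calc 10 * Real.exp 1 * c * y
        ≤ Real.exp 4 * Real.exp 1 * Real.exp (y ^ 2 / 9) * Real.exp (2 * y ^ 2 / 9) := by gcongr
      _ = Real.exp (4 + 1 + y ^ 2 / 9 + 2 * y ^ 2 / 9) := by simp only [Real.exp_add]
      _ ≤ _ := by gcongr; linarith
  calc 20 * (k : ℝ) * (10 * Real.exp 1 * c * y) ^ k * Real.exp k
      ≤ Real.exp (3 * k) * Real.exp (y ^ 2 - 4) ^ k * Real.exp k := by gcongr
    _ = Real.exp (y ^ 2 * k) := by
      rw [← Real.exp_nat_mul, ← Real.exp_add, ← Real.exp_add]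
      congr 1
      ring

/-- Independence of order zero is no constraint, so a point mass at the all-ones vector serves. -/
lemma not_kWiseTailBound_zero {n : ℕ} {δ T : ℝ} (hδ : δ < 1) (hT : T ≤ n) :
    ¬ KWiseTailBound n δ T 0 := by
  intro h
  have h1 := h (PMF.pure 1) (by
    intro S hS a
    obtain rfl : S = ∅ := by simpa using hS
    rw [cubeProb, PMF.toOuterMeasure_pure_apply, if_pos (by simp)]
    simp) 1
  have hmem : (1 : Fin n → ℤˣ) ∈ {x : Fin n → ℤˣ | T ≤ |signDot x 1|} := by
    simpa [signDot] using hT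
  rw [cubeProb, PMF.toOuterMeasure_pure_apply, if_pos hmem] at h1
  simp only [ENNReal.toReal_one] at h1
  linarith

set_option maxHeartbeats 1000000 in
lemma not_kWiseTailBound_of_pos {n k : ℕ} {c δ : ℝ} (hc : 5 ≤ c) (hδ : 0 < δ) (hk : 0 < k)
    (hkL : k * (9 * Real.log c) ≤ Real.log (1 / δ))
    (hn : (12 * c) ^ 2 * (3 * Real.log (1 / δ)) ^ 3 ≤ (n : ℝ)) :
    ¬ KWiseTailBound n δ (c * Real.sqrt (n * Real.log (1 / δ))) k := by
  set L := Real.log (1 / δ) with hL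
  have hδL : δ = Real.exp (-L) := by
    rw [hL, one_div, Real.log_inv, neg_neg, Real.exp_log hδ]
  have hlog := eight_fifths_le_log hc
  have hk1 : (1 : ℝ) ≤ k := by exact_mod_cast hk
  have hk0 : (0 : ℝ) < k := by linarith
  have hLk : 14.4 * k ≤ L := by
    have := mul_le_mul_of_nonneg_left hlog hk0.le
    linarith
  have hL1 : 14.4 ≤ L := by linarith
  have hnc : c ^ 2 * L * 3888 * L ^ 2 ≤ (n : ℝ) := by
    calc c ^ 2 * L * 3888 * L ^ 2 = (12 * c) ^ 2 * (3 * L) ^ 3 := by ring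
      _ ≤ (n : ℝ) := hn
  have hL2 : 14.4 ^ 2 ≤ L ^ 2 := by gcongr
  have hc2 : (25 : ℝ) ≤ c ^ 2 := by nlinarith
  have hn1 : 16 * (c ^ 2 * L) ≤ (n : ℝ) := by
    refine le_trans ?_ hnc
    have h0 : 0 ≤ c ^ 2 * L := by positivity
    have h1 : c ^ 2 * L * 3888 * 14.4 ^ 2 ≤ c ^ 2 * L * 3888 * L ^ 2 := by gcongr
    linarith
  have hn2 : 1000000 * (k : ℝ) ≤ n := by
    refine le_trans ?_ hnc
    have : 25 * L ≤ c ^ 2 * L := by gcongr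
    have h2 : 25 * L * 3888 * 14.4 ^ 2 ≤ c ^ 2 * L * 3888 * L ^ 2 := by gcongr
    linarith
  -- In the scales `n = k r²` and `L = k y²` the threshold is `T = c k y r`.
  set r := Real.sqrt (n / k) with hr
  have hr0 : 0 ≤ r := Real.sqrt_nonneg _
  have hr2 : k * r ^ 2 = (n : ℝ) := by
    rw [hr, Real.sq_sqrt (by positivity)]; field_simp
  have hr1000 : 1000 ≤ r := by
    refine Real.le_sqrt_of_sq_le ?_
    rw [le_div_iff₀ hk0]; linarith
  set y := Real.sqrt (L / k) with hy
  have hy0 : 0 ≤ y := Real.sqrt_nonneg _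
  have hy2 : y ^ 2 * k = L := by
    rw [hy, Real.sq_sqrt (by positivity)]; field_simp
  have hy9 : 9 * Real.log c ≤ y ^ 2 := by
    refine le_of_mul_le_mul_right ?_ hk0
    linarith
  have hy3 : 3.7 ≤ y := by
    refine Real.le_sqrt_of_sq_le ?_
    rw [le_div_iff₀ hk0]
    linarith
  have hT : c * Real.sqrt (n * L) = c * k * y * r := by
    rw [mul_assoc c, mul_assoc c]
    congr 1
    rw [show (n : ℝ) * L = (k * y * r) ^ 2 by rw [← hr2, ← hy2]; ring]
    exact Real.sqrt_sq (by positivity)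
  rw [hT]
  set T := c * k * y * r with hTdef
  have hky : 3.7 ≤ k * y := by
    have : 1 * 3.7 ≤ k * y := by gcongr
    linarith
  have hT18 : 18 * r ≤ T := by
    have : 5 * 3.7 * r ≤ c * (k * y) * r := by gcongr
    linarith
  have hT4 : 4 * T ≤ n := by
    have h1 : (4 * (c * y)) ^ 2 ≤ r ^ 2 := by
      refine le_of_mul_le_mul_left ?_ hk0
      calc k * (4 * (c * y)) ^ 2 = 16 * (c ^ 2 * L) := by rw [← hy2]; ring
        _ ≤ k * r ^ 2 := by rw [hr2]; exact hn1
    have h2 := abs_le_of_sq_le_sq' h1 hr0 |>.2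
    calc 4 * T = k * r * (4 * (c * y)) := by rw [hTdef]; ring
      _ ≤ k * r * r := by gcongr
      _ = n := by rw [← hr2]; ring
  -- Then `w (k+1) ≤ r k / 2`, so with `D ≥ n/4` the Gaussian exponent over the central blocks is at
  -- most `k`.
  set w := ⌊r / 4⌋₊ with hwdef
  have hw4 : (w : ℝ) ≤ r / 4 := Nat.floor_le (by positivity)
  have hw5 : r / 5 ≤ w := by
    have := Nat.lt_floor_add_one (r / 4)
    rw [← hwdef] at this
    linarith
  have hw0 : (0 : ℝ) < w := by linarith
  -- The first block lying wholly beyond `T`, up to rounding.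
  set M := ⌈(T + 1) / (2 * w)⌉₊ with hMdef
  have hM1 : (T + 1) ≤ M * (2 * w) := by
    rw [← div_le_iff₀ (by positivity)]
    exact Nat.le_ceil _
  have hM2 : w * (M : ℝ) ≤ (T + 1) / 2 + w := by
    have := Nat.ceil_lt_add_one (a := (T + 1) / (2 * w)) (by positivity)
    rw [← hMdef] at this
    calc w * (M : ℝ) ≤ w * ((T + 1) / (2 * w) + 1) := by gcongr
      _ = _ := by field_simp
  have hM5 : (M : ℝ) ≤ 5 * (c * k * y) := by
    have h1 : w * (M : ℝ) ≤ T := by linarith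
    have h2 : r / 5 * M ≤ w * M := by gcongr
    have hr0' : 0 < r := by linarith
    refine le_of_mul_le_mul_left ?_ hr0'
    calc r * (M : ℝ) = 5 * (r / 5 * M) := by ring
      _ ≤ 5 * T := by linarith
      _ = _ := by rw [hTdef]; ring
  have hkM : k < M := by
    have h1 : c * k * y * r ≤ M * (2 * (r / 4)) := by
      refine le_trans ?_ (hM1.trans (by gcongr))
      linarith
    have hr0' : 0 < r := by linarith
    have h2 : c * k * y * 2 ≤ M := by
      refine le_of_mul_le_mul_right ?_ hr0'
      linarith
    have h3 : 5 * k * 3.7 ≤ c * k * y := by gcongr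
    have : (k : ℝ) < M := by linarith
    exact_mod_cast this
  have hu : ((w * (k + 1) : ℕ) : ℝ) ≤ r * k / 2 := by
    push_cast
    calc (w : ℝ) * (k + 1) ≤ r / 4 * (2 * k) := by gcongr; linarith
      _ = _ := by ring
  have hnat1 : 2 * (w * (M + 1)) ≤ n := by
    have : (2 * (w * (M + 1)) : ℝ) ≤ n := by linarith
    exact_mod_cast this
  have hrk : r * k / 2 * 4 + 12 ≤ n := by
    have h1 : r * k * 1000 ≤ r * k * r := by gcongr
    have h2 : 1000 * 1 ≤ r * k := by gcongr
    rw [← hr2]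
    linarith
  have hnat2 : 4 * (w * (k + 1)) + 12 ≤ n := by
    have : 4 * ((w * (k + 1) : ℕ) : ℝ) + 12 ≤ n := by linarith
    exact_mod_cast this
  have hD4 : (n : ℝ) ≤ 4 * ((n / 4 + 1 : ℕ) : ℝ) := by exact_mod_cast (by omega)
  refine not_kWiseTailBound_of_params (w := w) (M := M) (D := n / 4 + 1) hδ hk
    (by exact_mod_cast hw0) hkM (by omega) (by omega) (by omega) (by linarith) ?_
  have hDpos : (0 : ℝ) < ((n / 4 + 1 : ℕ) : ℝ) := by positivity
  have hexp : ((w * (k + 1) : ℕ) : ℝ) ^ 2 / ((n / 4 + 1 : ℕ) : ℝ) ≤ k := by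
    rw [div_le_iff₀ hDpos]
    calc ((w * (k + 1) : ℕ) : ℝ) ^ 2 ≤ (r * k / 2) ^ 2 := by gcongr
      _ = (k : ℝ) * ((n : ℝ) / 4) := by rw [← hr2]; ring
      _ ≤ _ := by gcongr; linarith
  have hsqrt : Real.sqrt (2 * (n + 1)) ≤ 2 * k * r := by
    refine Real.sqrt_le_iff.2 ⟨by positivity, ?_⟩
    calc 2 * ((n : ℝ) + 1) ≤ 4 * n := by linarith
      _ = 4 * k * r ^ 2 := by rw [← hr2]; ring
      _ ≤ 4 * k * r ^ 2 * k := le_mul_of_one_le_right (by positivity) hk1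
      _ = _ := by ring
  have hr0' : 0 < r := by linarith
  have hnum := mul_pow_le_exp hk hc hy0 hy9
  rw [hy2] at hnum
  calc 2 * δ / w * (2 * Real.exp 1 * M / k) ^ k
      ≤ 2 * δ / (r / 5) * (2 * Real.exp 1 * (5 * (c * k * y)) / k) ^ k := by gcongr
    _ = 10 * Real.exp (-L) / r * (10 * Real.exp 1 * c * y) ^ k := by
        rw [← hδL, show 2 * Real.exp 1 * (5 * (c * k * y)) / k = 10 * Real.exp 1 * c * y by
          field_simp; ring]
        field_simp
        ring
    _ ≤ Real.exp (-k) / (2 * k * r) := by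
        rw [Real.exp_neg, Real.exp_neg, div_mul_eq_mul_div, div_le_div_iff₀ hr0' (by positivity)]
        calc 10 * (Real.exp L)⁻¹ * (10 * Real.exp 1 * c * y) ^ k * (2 * k * r)
            = (20 * k * (10 * Real.exp 1 * c * y) ^ k * Real.exp k) * (Real.exp L)⁻¹ *
              (Real.exp k)⁻¹ * r := by field_simp; ring
          _ ≤ Real.exp L * (Real.exp L)⁻¹ * (Real.exp k)⁻¹ * r := by gcongr
          _ = _ := by rw [mul_inv_cancel₀ (Real.exp_pos L).ne', one_mul]
    _ ≤ _ := by gcongr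

/-! ### Passage to the minimum. -/

lemma not_kWiseTailBound {n k : ℕ} {c δ : ℝ} (hc : 5 ≤ c) (hδ : 0 < δ) (hδ1 : δ < 1)
    (hT : c * Real.sqrt (n * Real.log (1 / δ)) ≤ n)
    (hn : (12 * c) ^ 2 * (3 * Real.log (1 / δ)) ^ 3 ≤ (n : ℝ))
    (hk : (k : ℝ) ≤ Real.log (1 / δ) / (9 * Real.log c)) :
    ¬ KWiseTailBound n δ (c * Real.sqrt (n * Real.log (1 / δ))) k := by
  rcases Nat.eq_zero_or_pos k with rfl | hk0
  · exact not_kWiseTailBound_zero hδ1 hT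
  · refine not_kWiseTailBound_of_pos hc hδ hk0 ?_ hn
    have := eight_fifths_le_log hc
    rwa [le_div_iff₀ (by linarith)] at hk

/-- A finite infimum is attained by well-ordering, so excluding every `k ≤ a` gives a strict
inequality. -/
lemma coe_lt_minIndependence {n : ℕ} {δ T a : ℝ}
    (h : ∀ k : ℕ, (k : ℝ) ≤ a → ¬ KWiseTailBound n δ T k) :
    (a : EReal) < ((minIndependence n δ T : ENNReal) : EReal) := by
  rcases eq_or_ne (minIndependence n δ T) ⊤ with htop | htop
  · rw [htop]
    simp
  · have hne : {k : ℕ | KWiseTailBound n δ T k}.Nonempty := by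
      by_contra hcon
      apply htop
      rw [minIndependence, iInf₂_eq_top]
      intro k hk
      exact absurd ⟨k, hk⟩ hcon
    have heq : minIndependence n δ T = ((sInf {k : ℕ | KWiseTailBound n δ T k} : ℕ) : ℕ∞) := by
      refine le_antisymm (iInf₂_le _ (Nat.sInf_mem hne)) (le_iInf₂ fun k hk => ?_)
      exact_mod_cast Nat.sInf_le hk
    have hlt : a < (sInf {k : ℕ | KWiseTailBound n δ T k} : ℕ) := by
      by_contra hcon
      exact h _ (not_lt.1 hcon) (Nat.sInf_mem hne)
    have hcast : ∀ m : ℕ, (((m : ℕ∞) : ENNReal) : EReal) = ((m : ℝ) : EReal) := fun m => by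
      rw [ENat.toENNReal_coe, EReal.coe_natCast]
      rfl
    rw [heq, hcast]
    exact EReal.coe_lt_coe_iff.2 hlt

end

theorem mainTheorem3 :
    (∀ (n : ℕ) (c δ T : ℝ), 5 ≤ c → 0 < δ → δ < 1 →
      T = c * Real.sqrt ((n : ℝ) * Real.log (1 / δ)) → T ≤ (n : ℝ) →
      (12 * c) ^ 2 * (3 * Real.log (1 / δ)) ^ 3 ≤ (n : ℝ) →
      ((Real.log (1 / δ) / (9 * Real.log c) : ℝ) : EReal) <
        ((minIndependence n δ T : ENNReal) : EReal)) ∧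
    (∃ C : ℝ, 0 < C ∧ ∀ c δ : ℝ, 5 < c → 0 < δ → δ < 1 →
      ∃ N : ℕ, ∀ n : ℕ, N ≤ n →
        ((C * Real.logb c (1 / δ) : ℝ) : EReal) ≤
          ((minIndependence n δ (c * Real.sqrt ((n : ℝ) * Real.log (1 / δ))) : ENNReal) :
            EReal)) := by
  have hA : ∀ (n : ℕ) (c δ : ℝ), 5 ≤ c → 0 < δ → δ < 1 →
      c * Real.sqrt ((n : ℝ) * Real.log (1 / δ)) ≤ (n : ℝ) →
      (12 * c) ^ 2 * (3 * Real.log (1 / δ)) ^ 3 ≤ (n : ℝ) →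
      ((Real.log (1 / δ) / (9 * Real.log c) : ℝ) : EReal) <
        ((minIndependence n δ (c * Real.sqrt ((n : ℝ) * Real.log (1 / δ))) : ENNReal) :
          EReal) :=
    fun n c δ hc hδ hδ1 hT hn =>
      coe_lt_minIndependence fun k hk => not_kWiseTailBound hc hδ hδ1 hT hn hk
  refine ⟨fun n c δ T hc hδ hδ1 hT hTn hn => ?_, 1 / 9, by norm_num, fun c δ hc hδ hδ1 => ?_⟩
  · subst hT
    exact hA n c δ hc hδ hδ1 hTn hn
  · set L := Real.log (1 / δ) with hL
    -- The first entry of the maximum ensures `T ≤ n`, since `T² = c² L n`; the second is the size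
    -- hypothesis of part (a).
    refine ⟨⌈max (c ^ 2 * L) ((12 * c) ^ 2 * (3 * L) ^ 3)⌉₊, fun n hn => ?_⟩
    have hn' := Nat.ceil_le.1 hn
    have h1 : c ^ 2 * L ≤ n := (le_max_left _ _).trans hn'
    have h2 : (12 * c) ^ 2 * (3 * L) ^ 3 ≤ n := (le_max_right _ _).trans hn'
    have hL0 : 0 ≤ L := Real.log_nonneg (by rw [le_div_iff₀ hδ]; linarith)
    have hT : c * Real.sqrt (n * L) ≤ n := by
      refine abs_le_of_sq_le_sq' ?_ (Nat.cast_nonneg n) |>.2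
      rw [mul_pow, Real.sq_sqrt (by positivity)]
      nlinarith [(Nat.cast_nonneg n : (0 : ℝ) ≤ n)]
    have := hA n c δ hc.le hδ hδ1 hT h2
    rw [Real.logb, show 1 / 9 * (Real.log (1 / δ) / Real.log c) =
      Real.log (1 / δ) / (9 * Real.log c) by rw [div_mul_div_comm, one_mul]]
    exact this.le
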